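/- Let $G$ be a torsion-free abelian group, written additively. For a finite set $A\subseteq G$ and a positive integer $n$ put $$n\,\tilde{}A=\{a_1+\cdots+a_n:\ a_1,\ldots,a_n\in A,\ a_i\neq a_{i+1}\ \text{for all } 1\le i<n\}$$ and $$n^{\circ}A=\{a_1+\cdots+a_n:\ a_1,\ldots,a_n\in A,\ a_i\neq a_{i+1}\ \text{for all } 1\le i<n,\ \text{and } a_n\neq a_1\},$$ and let $\{n\}_2\in\{0,1\}$ denote the least nonnegative residue of $n$ modulo $2$. Call $A$ an arithmetic progression if $A=\{a,a+d,\ldots,a+(|A|-1)d\}$ for some $a,d\in G$. Let $n>2$ be an integer and let $A$ be a finite subset of $G$ with $|A|\ge 3$. Then $$|n\,\tilde{}A|=n|A|-2n+1+\{n\}_2$$ if and only if $A$ is an arithmetic progression. Also, $$|n^{\circ}A|=n|A|-2n+(-1)^n(1+\{n\}_2)$$ if and only if $A$ is an arithmetic progression, or $|A|=3$ and $n=5$, or $n=3$ and $|A|\in\{3,4\}$. -/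

import Mathlib

/-- The linearly restricted sumset `L(A₁, …, Aₙ)`: all sums `a₁ + ⋯ + aₙ` with `aᵢ ∈ Aᵢ` for
every `i` and `aᵢ ≠ aᵢ₊₁` for any two consecutive indices. -/
def linearSumset {G : Type*} [AddCommGroup G] [DecidableEq G] {n : ℕ}
    (A : Fin n → Finset G) : Finset G :=
  ((Fintype.piFinset A).filter fun a =>
    ∀ i j : Fin n, (i : ℕ) + 1 = (j : ℕ) → a i ≠ a j).image fun a => ∑ i, a i

/-- The circularly restricted sumset `C(A₁, …, Aₙ)`: all sums `a₁ + ⋯ + aₙ` with `aᵢ ∈ Aᵢ` for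
every `i`, with `aᵢ ≠ aᵢ₊₁` for any two consecutive indices, and with `aₙ ≠ a₁`. -/
def circularSumset {G : Type*} [AddCommGroup G] [DecidableEq G] {n : ℕ}
    (A : Fin n → Finset G) : Finset G :=
  ((Fintype.piFinset A).filter fun a =>
    (∀ i j : Fin n, (i : ℕ) + 1 = (j : ℕ) → a i ≠ a j) ∧
    (∀ i j : Fin n, (i : ℕ) + 1 = n → (j : ℕ) = 0 → a i ≠ a j)).image fun a => ∑ i, a i

/-- `n ~ A = L(A, …, A)` with `n` copies of `A`. -/
def linearMultiple {G : Type*} [AddCommGroup G] [DecidableEq G] (n : ℕ) (A : Finset G) :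
    Finset G :=
  linearSumset fun _ : Fin n => A

/-- `n ° A = C(A, …, A)` with `n` copies of `A`. -/
def circularMultiple {G : Type*} [AddCommGroup G] [DecidableEq G] (n : ℕ) (A : Finset G) :
    Finset G :=
  circularSumset fun _ : Fin n => A

/-- `A` is an arithmetic progression: `A = {a, a + d, …, a + (k - 1) d}` where `k = |A|`
(so that these `k` terms are pairwise distinct). -/
def IsArithProg {G : Type*} [AddCommGroup G] [DecidableEq G] (A : Finset G) : Prop :=
  ∃ a d : G, A = (Finset.range A.card).image fun i : ℕ => a + i • d

/-!
Interleaving the two halves of a suitably sorted multiset shows that a sum `∑ cᵢ • aᵢ` of `n` terms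
lies in `n ~ A` exactly when every multiplicity `cᵢ` is at most `⌈n/2⌉`, and in `n ° A` exactly when
every `cᵢ` is at most `⌊n/2⌋` (`mem_linearMultiple_iff`, `mem_circularMultiple_iff`). The theorem is
thus about sums of `n` terms in which no term is repeated more than `r` times.

Order `G` linearly (`exists_linearOrder_isOrderedAddMonoid`) and let `a₀ < ⋯ < aₖ₋₁` be the elements
of `A`. Moving one unit of multiplicity from `aᵢ` to `aᵢ₊₁` increases the sum and raises the level
`∑ i cᵢ` by one. A multiset that allows no such move is packed at the top, one that allows no
inverse move is packed at the bottom, and both extreme levels depend only on `n`, `k` and `r`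
(`IsMultiplicity.level_eq_of_packed`). Hence there are at least as many sums as levels
(`le_card_boundedSums`). If there are exactly as many, a sum is determined by its level
(`value_eq_of_level_eq`), so whenever two moves are available from the same multiset, the two gaps
`aᵢ₊₁ - aᵢ` involved agree (`gap_eq_of_card_eq`). Suitable multisets make all gaps equal
(`gap_eq_gap_zero`), except when `r = 1`, `k ≤ 4` or `n = 5`, `r = 2`, `k = 3`; there, the few
multisets can be listed and the lower bound is always attained. Conversely, the sums of an
arithmetic progression are determined by their levels.
-/

open Finset

/-! ### Linear orders on torsion-free abelian groups -/

/-- A torsion-free abelian group embeds in its divisible hull, a rational vector space; a basis of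
that space identifies it with finitely supported functions, which are ordered lexicographically. -/
theorem exists_linearOrder_isOrderedAddMonoid (G : Type*) [AddCommGroup G] [IsAddTorsionFree G] :
    ∃ _ : LinearOrder G, IsOrderedAddMonoid G := by
  classical
  let b := Module.Basis.ofVectorSpace ℚ (DivisibleHull G)
  let ι := Module.Basis.ofVectorSpaceIndex ℚ (DivisibleHull G)
  let : LinearOrder ι := linearOrderOfSTO WellOrderingRel
  let f : G → Lex (ι →₀ ℚ) := fun g => toLex (b.repr (g : DivisibleHull G))
  have hf : Function.Injective f := fun x y h =>
    DivisibleHull.coe_injective (b.repr.injective (toLex.injective h))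
  have hadd : ∀ x y, f (x + y) = f x + f y := fun x y => by
    simp only [f, DivisibleHull.coe_add, map_add, toLex_add]
  let o : LinearOrder G := LinearOrder.lift' f hf
  refine ⟨o, { add_le_add_left := fun x y h z => ?_ }⟩
  change f (x + z) ≤ f (y + z)
  rw [hadd, hadd]
  exact add_le_add_left (show f x ≤ f y from h) _

/-! ### Arranging a multiset so that neighbours differ -/

section Arrangement

variable {α : Type*} [DecidableEq α] {n : ℕ}

/-- If no value is taken more than `⌈n/2⌉` times, the terms of a finite sequence can be permuted so
that consecutive terms differ; if no value is taken more than `⌊n/2⌋` times, the last term then also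
differs from the first. Group equal terms together, starting with a most frequent value, and
interleave the first half of the resulting sequence with the second half. -/
theorem exists_perm_forall_ne (x : Fin n → α)
    (hx : ∀ v, #{j | x j = v} ≤ (n + 1) / 2) :
    ∃ σ : Equiv.Perm (Fin n),
      (∀ i j : Fin n, (i : ℕ) + 1 = (j : ℕ) → x (σ i) ≠ x (σ j)) ∧
      ((∀ v, #{j | x j = v} ≤ n / 2) →
        ∀ i j : Fin n, (i : ℕ) + 1 = n → (j : ℕ) = 0 → x (σ i) ≠ x (σ j)) := by
  rcases Nat.eq_zero_or_pos n with rfl | hn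
  · exact ⟨1, fun i => i.elim0, fun _ i => i.elim0⟩
  have : Nonempty (Fin n) := ⟨⟨0, hn⟩⟩
  obtain ⟨j₀, hj₀⟩ := Finite.exists_max fun j => #{t | x t = x j}
  -- `f` orders the values, with the most frequent one at the bottom.
  let f : α → WithBot Cardinal := fun v => if v = x j₀ then ⊥ else embeddingToCardinal v
  have hf : Function.Injective f := by
    intro u v h
    by_cases hu : u = x j₀ <;> by_cases hv : v = x j₀ <;> simp_all [f]
  have hbot : ∀ v, f v = ⊥ → v = x j₀ := by
    intro v h
    by_contra hv
    simp [f, hv] at h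
  let ρ := Tuple.sort (f ∘ x)
  have hmono : Monotone fun i => f (x (ρ i)) := Tuple.monotone_sort (f ∘ x)
  have hcard : ∀ v, #{j | x (ρ j) = v} = #{j | x j = v} := fun v =>
    card_bij (fun j _ => ρ j) (by simp) (by simp) fun j hj => ⟨ρ.symm j, by simpa using hj, by simp⟩
  -- Equal terms of the sorted sequence bound a constant block.
  have hblock : ∀ i j : Fin n, i ≤ j → x (ρ i) = x (ρ j) →
      (j : ℕ) + 1 ≤ #{t | x t = x (ρ j)} + i := by
    intro i j hij h
    rw [← hcard]
    have hsub : Icc i j ⊆ ({t | x (ρ t) = x (ρ j)} : Finset (Fin n)) := by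
      intro t ht
      rw [mem_Icc] at ht
      simp only [mem_filter, mem_univ, true_and]
      exact hf (le_antisymm (hmono ht.2) (h ▸ hmono ht.1))
    have := card_le_card hsub
    rw [Fin.card_Icc] at this
    omega
  -- The most frequent value occupies the initial block.
  have hfirst : ∀ i : Fin n, x (ρ i) ≠ x j₀ → #{t | x t = x j₀} ≤ i := by
    intro i hi
    rw [← hcard, ← Fin.card_Iio]
    refine card_le_card fun t ht => ?_
    simp only [mem_filter, mem_univ, true_and] at ht
    rw [mem_Iio]
    by_contra hlt
    refine hi (hbot _ (le_bot_iff.1 ?_))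
    have := hmono (not_lt.1 hlt)
    simpa [ht, f] using this
  have hinit : ∀ i : Fin n, x (ρ i) = x j₀ → (i : ℕ) + 1 ≤ #{t | x t = x j₀} := by
    intro i hi
    have hi0 : (⟨0, hn⟩ : Fin n) ≤ i := Nat.zero_le _
    have h0 : x (ρ ⟨0, hn⟩) = x (ρ i) := by
      rw [hi]
      refine hbot _ (le_bot_iff.1 ?_)
      have := hmono hi0
      simpa [hi, f] using this
    have := hblock _ i hi0 h0
    rw [hi] at this
    simpa using this
  let τ : Fin n → Fin n := fun j =>
    if h : (j : ℕ) % 2 = 0 then ⟨j / 2, by omega⟩ else ⟨(n + 1) / 2 + j / 2, by omega⟩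
  have hτ0 : ∀ j : Fin n, (j : ℕ) % 2 = 0 → (τ j : ℕ) = j / 2 := fun j h => by simp [τ, h]
  have hτ1 : ∀ j : Fin n, (j : ℕ) % 2 = 1 → (τ j : ℕ) = (n + 1) / 2 + j / 2 :=
    fun j h => by simp [τ, h]
  have hτ : Function.Injective τ := by
    intro i j h
    have h' : (τ i : ℕ) = τ j := congrArg Fin.val h
    apply Fin.ext
    rcases Nat.mod_two_eq_zero_or_one i with hi | hi <;>
      rcases Nat.mod_two_eq_zero_or_one j with hj | hj <;>
      simp only [hτ0, hτ1, hi, hj] at h' <;> omega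
  let σ : Equiv.Perm (Fin n) := (Equiv.ofBijective τ (Finite.injective_iff_bijective.1 hτ)).trans ρ
  have hσ : ∀ j, σ j = ρ (τ j) := fun _ => rfl
  refine ⟨σ, fun i j hij h => ?_, fun hx' i j hi hj h => ?_⟩
  · rw [hσ, hσ] at h
    rcases Nat.mod_two_eq_zero_or_one i with hi | hi
    · have h1 := hτ0 i hi
      have h2 := hτ1 j (by omega)
      have := hblock (τ i) (τ j) (Fin.le_def.2 (by omega)) h
      have := hx (x (ρ (τ j)))
      omega
    · have h1 := hτ1 i hi
      have h2 := hτ0 j (by omega)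
      have h3 := hblock (τ j) (τ i) (Fin.le_def.2 (by omega)) h.symm
      have h4 := hj₀ (ρ (τ i))
      have h5 := hx (x j₀)
      by_cases hp : x (ρ (τ i)) = x j₀
      · have := hinit _ hp
        omega
      · have := hfirst (τ j) (h ▸ hp)
        omega
  · rw [hσ, hσ] at h
    have h0 := hτ0 j (by omega)
    have h1 := hblock (τ j) (τ i) (Fin.le_def.2 (by omega)) h.symm
    have h2 := hx' (x (ρ (τ i)))
    rcases Nat.mod_two_eq_zero_or_one i with hi' | hi'
    · have := hτ0 i hi'
      omega
    · have := hτ1 i hi'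
      omega

theorem card_fiber_le_of_forall_ne (x : Fin n → α)
    (hx : ∀ i j : Fin n, (i : ℕ) + 1 = (j : ℕ) → x i ≠ x j) (v : α) :
    #{j | x j = v} ≤ (n + 1) / 2 := by
  rw [← card_range ((n + 1) / 2)]
  refine card_le_card_of_injOn (fun j => (j : ℕ) / 2) (fun j _ => ?_) fun i hi j hj h => ?_
  · simp only [coe_range, Set.mem_Iio]
    omega
  · simp only [coe_filter, mem_univ, true_and, Set.mem_ofPred_eq] at hi hj h
    by_contra hne
    rcases lt_or_gt_of_ne (Fin.val_ne_of_ne hne) with hlt | hlt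
    · exact hx i j (by omega) (hi.trans hj.symm)
    · exact hx j i (by omega) (hj.trans hi.symm)

theorem card_fiber_le_of_forall_ne_of_last_ne (x : Fin n → α)
    (hx : ∀ i j : Fin n, (i : ℕ) + 1 = (j : ℕ) → x i ≠ x j)
    (hx' : ∀ i j : Fin n, (i : ℕ) + 1 = n → (j : ℕ) = 0 → x i ≠ x j) (v : α) :
    #{j | x j = v} ≤ n / 2 := by
  -- The fibre misses an end of the sequence; pair up the remaining positions from the other end.
  rw [← card_range (n / 2)]
  by_cases h0 : ∃ j : Fin n, (j : ℕ) = 0 ∧ x j = v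
  · obtain ⟨z, hz, hzv⟩ := h0
    refine card_le_card_of_injOn (fun j => (j : ℕ) / 2) (fun j hj => ?_) fun i hi j hj h => ?_
    · simp only [coe_filter, mem_univ, true_and, Set.mem_ofPred_eq] at hj
      have : (j : ℕ) + 1 ≠ n := fun h => hx' j z h hz (hj.trans hzv.symm)
      simp only [coe_range, Set.mem_Iio]
      omega
    · simp only [coe_filter, mem_univ, true_and, Set.mem_ofPred_eq] at hi hj h
      by_contra hne
      rcases lt_or_gt_of_ne (Fin.val_ne_of_ne hne) with hlt | hlt
      · exact hx i j (by omega) (hi.trans hj.symm)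
      · exact hx j i (by omega) (hj.trans hi.symm)
  · push Not at h0
    refine card_le_card_of_injOn (fun j => ((j : ℕ) - 1) / 2) (fun j hj => ?_)
      fun i hi j hj h => ?_
    · simp only [coe_filter, mem_univ, true_and, Set.mem_ofPred_eq] at hj
      have : (j : ℕ) ≠ 0 := fun h => h0 j h hj
      simp only [coe_range, Set.mem_Iio]
      omega
    · simp only [coe_filter, mem_univ, true_and, Set.mem_ofPred_eq] at hi hj h
      have : (i : ℕ) ≠ 0 := fun h => h0 i h hi
      have : (j : ℕ) ≠ 0 := fun h => h0 j h hj
      by_contra hne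
      rcases lt_or_gt_of_ne (Fin.val_ne_of_ne hne) with hlt | hlt
      · exact hx i j (by omega) (hi.trans hj.symm)
      · exact hx j i (by omega) (hj.trans hi.symm)

end Arrangement

/-! ### Restricted sumsets through multiplicities -/

/-- `c` lists the multiplicities `c 0, …, c (k - 1)` of a multiset of size `n` on `k` points in
which no point is repeated more than `r` times; the values of `c` from `k` on are irrelevant. -/
def IsMultiplicity (k n r : ℕ) (c : ℕ → ℕ) : Prop :=
  (∀ i < k, c i ≤ r) ∧ ∑ i ∈ range k, c i = n

section Multiplicity

variable {G : Type*} [AddCommGroup G] [DecidableEq G] {k n r : ℕ} {a : ℕ → G}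

theorem exists_isMultiplicity (ha : Set.InjOn a (range k)) (x : Fin n → G)
    (hx : ∀ j, x j ∈ (range k).image a) (hr : ∀ v, #{j | x j = v} ≤ r) :
    ∃ c, IsMultiplicity k n r c ∧ ∑ i ∈ range k, c i • a i = ∑ j, x j := by
  refine ⟨fun i => #{j | x j = a i}, ⟨fun i _ => hr _, ?_⟩, ?_⟩
  · rw [← sum_image (f := fun v => #{j | x j = v}) ha,
      ← card_eq_sum_card_fiberwise fun j _ => hx j, card_univ, Fintype.card_fin]
  · rw [← sum_image (f := fun v => #{j | x j = v} • v) ha,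
      ← sum_fiberwise_of_maps_to (g := x) (fun j _ => hx j)]
    refine sum_congr rfl fun v _ => ?_
    rw [← sum_const]
    exact sum_congr rfl fun j hj => (mem_filter.1 hj).2.symm

theorem IsMultiplicity.exists_tuple {c : ℕ → ℕ} (hc : IsMultiplicity k n r c)
    (ha : Set.InjOn a (range k)) :
    ∃ x : Fin n → G, (∀ j, x j ∈ (range k).image a) ∧ (∀ v, #{j | x j = v} ≤ r) ∧
      ∑ j, x j = ∑ i ∈ range k, c i • a i := by
  have hcard : Fintype.card (Σ i : Fin k, Fin (c i)) = n := by
    simp only [Fintype.card_sigma, Fintype.card_fin]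
    rw [← hc.2, sum_range]
  let e : Fin n ≃ Σ i : Fin k, Fin (c i) := (finCongr hcard.symm).trans (Fintype.equivFin _).symm
  refine ⟨fun j => a (e j).1, fun j => mem_image_of_mem _ (mem_range.2 (e j).1.2), fun v => ?_, ?_⟩
  · rw [← card_range r]
    refine card_le_card_of_injOn (fun j => ((e j).2 : ℕ)) (fun j _ => ?_) fun i hi j hj h => ?_
    · simp only [coe_range, Set.mem_Iio]
      exact (e j).2.2.trans_le (hc.1 _ (e j).1.2)
    · simp only [coe_filter, mem_univ, true_and, Set.mem_ofPred_eq] at hi hj h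
      have h1 : (e i).1 = (e j).1 := Fin.ext
        (ha (by simp) (by simp) (hi.trans hj.symm))
      apply e.injective
      revert h1 h
      generalize e i = p
      generalize e j = q
      rcases p with ⟨p, s⟩
      rcases q with ⟨q, t⟩
      rintro h rfl
      simp only [Sigma.mk.injEq, heq_eq_eq, true_and]
      exact Fin.ext h
  · rw [e.sum_comp (fun p : Σ i : Fin k, Fin (c i) => a p.1), Fintype.sum_sigma, sum_range]
    simp

theorem mem_linearMultiple_iff (ha : Set.InjOn a (range k)) {s : G} :
    s ∈ linearMultiple n ((range k).image a) ↔
      ∃ c, IsMultiplicity k n ((n + 1) / 2) c ∧ ∑ i ∈ range k, c i • a i = s := by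
  simp only [linearMultiple, linearSumset, mem_image (s := filter _ _), mem_filter,
    Fintype.mem_piFinset]
  constructor
  · rintro ⟨x, ⟨hx, hne⟩, rfl⟩
    exact exists_isMultiplicity ha x hx (card_fiber_le_of_forall_ne x hne)
  · rintro ⟨c, hc, rfl⟩
    obtain ⟨x, hx, hr, hsum⟩ := hc.exists_tuple ha
    obtain ⟨σ, hσ, -⟩ := exists_perm_forall_ne x hr
    exact ⟨fun j => x (σ j), ⟨fun j => hx _, hσ⟩, by rw [Equiv.sum_comp σ x, hsum]⟩

theorem mem_circularMultiple_iff (ha : Set.InjOn a (range k)) {s : G} :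
    s ∈ circularMultiple n ((range k).image a) ↔
      ∃ c, IsMultiplicity k n (n / 2) c ∧ ∑ i ∈ range k, c i • a i = s := by
  simp only [circularMultiple, circularSumset, mem_image (s := filter _ _), mem_filter,
    Fintype.mem_piFinset]
  constructor
  · rintro ⟨x, ⟨hx, hne, hne'⟩, rfl⟩
    exact exists_isMultiplicity ha x hx (card_fiber_le_of_forall_ne_of_last_ne x hne hne')
  · rintro ⟨c, hc, rfl⟩
    obtain ⟨x, hx, hr, hsum⟩ := hc.exists_tuple ha
    obtain ⟨σ, hσ, hσ'⟩ := exists_perm_forall_ne x fun v => (hr v).trans (by omega)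
    exact ⟨fun j => x (σ j), ⟨fun j => hx _, hσ, hσ' hr⟩, by rw [Equiv.sum_comp σ x, hsum]⟩

end Multiplicity

/-! ### Values along a graded family -/

section Graded

variable {X G : Type*} [LinearOrder G] {P : X → Prop} {ℓ : X → ℤ} {v : X → G} {S : Finset G}

/-- If every element of a graded family that is not at the top level `M` lies one level below an
element of larger value, then the values exceeding that of `x` number at least `M - ℓ x`. -/
theorem sub_level_le_card_lt {M : ℤ} (hS : ∀ x, P x → v x ∈ S)
    (up : ∀ x, P x → ℓ x = M ∨ ∃ y, P y ∧ ℓ y = ℓ x + 1 ∧ v x < v y) (x : X) (hx : P x) :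
    ℓ x ≤ M ∧ M - ℓ x ≤ #{s ∈ S | v x < s} := by
  induction hN : #{s ∈ S | v x < s} using Nat.strong_induction_on generalizing x with
  | _ N ih =>
    rcases up x hx with h | ⟨y, hy, hℓ, hv⟩
    · omega
    · have hlt : #{s ∈ S | v y < s} < #{s ∈ S | v x < s} := by
        refine card_lt_card ⟨fun s hs => ?_, fun hsub => ?_⟩
        · rw [mem_filter] at hs ⊢
          exact ⟨hs.1, hv.trans hs.2⟩
        · have := hsub (mem_filter.2 ⟨hS y hy, hv⟩)
          exact lt_irrefl _ (mem_filter.1 this).2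
      have := ih _ (hN ▸ hlt) y hy rfl
      omega

theorem level_sub_le_card_gt {m : ℤ} (hS : ∀ x, P x → v x ∈ S)
    (down : ∀ x, P x → ℓ x = m ∨ ∃ y, P y ∧ ℓ x = ℓ y + 1 ∧ v y < v x) (x : X) (hx : P x) :
    m ≤ ℓ x ∧ ℓ x - m ≤ #{s ∈ S | s < v x} := by
  have := sub_level_le_card_lt (G := Gᵒᵈ) (ℓ := fun x => -ℓ x) (v := fun x => OrderDual.toDual (v x))
    (S := S) (M := -m) hS (fun x hx => (down x hx).imp (fun h => by rw [h])
      fun ⟨y, hy, hℓ, hv⟩ => ⟨y, hy, by omega, hv⟩) x hx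
  have h2 : #{s ∈ S | s < v x} = #(filter (α := Gᵒᵈ) (fun s => OrderDual.toDual (v x) < s) S) :=
    rfl
  rw [h2]
  omega

theorem card_filter_lt_add_card_filter_gt {s : G} (hs : s ∈ S) :
    #{t ∈ S | t < s} + #{t ∈ S | s < t} + 1 = #S := by
  have h1 := card_filter_add_card_filter_not (s := S) (fun t => t < s)
  have h2 : ({t ∈ S | ¬t < s} : Finset G) = insert s {t ∈ S | s < t} := by
    ext t
    simp only [mem_filter, mem_insert, not_lt, le_iff_lt_or_eq]
    constructor
    · rintro ⟨h, h' | h'⟩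
      · exact Or.inr ⟨h, h'⟩
      · exact Or.inl h'.symm
    · rintro (rfl | ⟨h, h'⟩)
      · exact ⟨hs, Or.inr rfl⟩
      · exact ⟨h, Or.inl h'⟩
  rw [h2, card_insert_of_notMem (by simp)] at h1
  omega

/-- When there are as few values as levels, the rank of a value among all values is determined by
the level, so the value itself is. -/
theorem value_eq_of_level_eq {m M : ℤ} (hS : ∀ x, P x → v x ∈ S)
    (up : ∀ x, P x → ℓ x = M ∨ ∃ y, P y ∧ ℓ y = ℓ x + 1 ∧ v x < v y)
    (down : ∀ x, P x → ℓ x = m ∨ ∃ y, P y ∧ ℓ x = ℓ y + 1 ∧ v y < v x)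
    (hcard : (#S : ℤ) = M - m + 1) {x y : X} (hx : P x) (hy : P y) (h : ℓ x = ℓ y) :
    v x = v y := by
  have hrank : ∀ z, P z → (#{s ∈ S | s < v z} : ℤ) = ℓ z - m := by
    intro z hz
    have h1 := sub_level_le_card_lt hS up z hz
    have h2 := level_sub_le_card_gt hS down z hz
    have h3 := card_filter_lt_add_card_filter_gt (hS z hz)
    omega
  have hlt : ∀ z w, P z → P w → v z < v w → #{s ∈ S | s < v z} < #{s ∈ S | s < v w} := by
    intro z w hz _ hzw
    refine card_lt_card ⟨fun s hs => ?_, fun hsub => ?_⟩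
    · rw [mem_filter] at hs ⊢
      exact ⟨hs.1, hs.2.trans hzw⟩
    · have := hsub (mem_filter.2 ⟨hS z hz, hzw⟩)
      exact lt_irrefl _ (mem_filter.1 this).2
  have hx' := hrank x hx
  have hy' := hrank y hy
  rcases lt_trichotomy (v x) (v y) with hxy | hxy | hxy
  · have := hlt x y hx hy hxy
    omega
  · exact hxy
  · have := hlt y x hy hx hxy
    omega

end Graded

/-! ### Moving one unit of multiplicity to a neighbour -/

/-- The level of a multiset of indices given by multiplicities `c 0, …, c (k - 1)`: the sum of the
indices. -/
def level (k : ℕ) (c : ℕ → ℕ) : ℕ := ∑ i ∈ range k, c i * i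

/-- The multiplicities obtained from `c` by moving one unit from `p` to `q`. -/
def moveUnit (c : ℕ → ℕ) (p q i : ℕ) : ℕ :=
  if i = p then c p - 1 else if i = q then c q + 1 else c i

section Move

variable {k n r p q : ℕ} {c : ℕ → ℕ}

theorem sum_moveUnit_add {M : Type*} [AddCommMonoid M] (F : ℕ → M) (hp : p < k) (hq : q < k)
    (hpq : p ≠ q) (hc : 1 ≤ c p) :
    ∑ i ∈ range k, moveUnit c p q i • F i + F p = ∑ i ∈ range k, c i • F i + F q := by
  have h : ∀ i, moveUnit c p q i + (Pi.single p 1 : ℕ → ℕ) i = c i + (Pi.single q 1 : ℕ → ℕ) i := by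
    intro i
    simp only [moveUnit, Pi.single_apply]
    split_ifs <;> subst_vars <;> omega
  have hs : ∀ t < k, ∑ i ∈ range k, (Pi.single t 1 : ℕ → ℕ) i • F i = F t := by
    intro t ht
    rw [sum_eq_single_of_mem t (mem_range.2 ht) fun i _ hi => by simp [hi]]
    simp
  calc _ = ∑ i ∈ range k, (moveUnit c p q i + (Pi.single p 1 : ℕ → ℕ) i) • F i := by
        simp only [add_smul, sum_add_distrib, hs p hp]
    _ = _ := by simp only [h, add_smul, sum_add_distrib, hs q hq]

theorem IsMultiplicity.moveUnit (hc : IsMultiplicity k n r c) (hp : p < k) (hq : q < k)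
    (hpq : p ≠ q) (hcp : 1 ≤ c p) (hcq : c q < r) : IsMultiplicity k n r (moveUnit c p q) := by
  refine ⟨fun i hi => ?_, ?_⟩
  · have := hc.1 i hi
    have := hc.1 p hp
    simp only [_root_.moveUnit]
    split_ifs <;> omega
  · have := sum_moveUnit_add (fun _ => 1) hp hq hpq hcp
    simp only [smul_eq_mul, mul_one, hc.2] at this
    omega

theorem level_moveUnit_add (hp : p < k) (hq : q < k) (hpq : p ≠ q) (hcp : 1 ≤ c p) :
    level k (moveUnit c p q) + p = level k c + q := by
  simpa [level] using sum_moveUnit_add (fun i => i) hp hq hpq hcp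

/-- A multiplicity function that admits no move to a lower neighbour is packed at the bottom, which
determines its level `β`: it is `(r, r, 1)` if `n = 2 * r + 1`, and `(r, n - r)` otherwise. The
hypothesis `hβ` covers both values `⌈n/2⌉` and `⌊n/2⌋` of the bound `r`. -/
theorem IsMultiplicity.level_eq_of_packed {β : ℕ} (hc : IsMultiplicity k n r c) (hk : 3 ≤ k)
    (hn : 2 < n)
    (hβ : n = 2 * r + 1 ∧ β = r + 2 ∨ n ≤ 2 * r ∧ 2 * r ≤ n + 1 ∧ n = β + r)
    (h : ∀ i, i + 1 < k → c (i + 1) = 0 ∨ r ≤ c i) : level k c = β := by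
  have hfull : ∀ d i, i + d + 1 < k → c (i + d + 1) ≠ 0 → r ≤ c i := by
    intro d
    induction d with
    | zero => exact fun i hi h0 => (h i hi).resolve_left h0
    | succ d ih =>
      intro i hi h0
      refine ih i (by omega) ?_
      have := (h (i + d + 1) hi).resolve_left h0
      omega
  have h3 : range 3 ⊆ range k := range_subset_range.2 hk
  have hzero : ∀ i ∈ range k, i ∉ range 3 → c i = 0 := by
    intro i hi hi3
    rw [mem_range] at hi hi3
    by_contra h0
    have e : ∀ j < 3, r ≤ c j := fun j hj =>
      hfull (i - j - 1) j (by omega) (by rwa [show j + (i - j - 1) + 1 = i by omega])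
    have h4 : ∑ j ∈ insert i (range 3), c j ≤ n := by
      rw [← hc.2]
      exact sum_le_sum_of_subset (insert_subset (mem_range.2 hi) h3)
    rw [sum_insert (by simpa using hi3)] at h4
    simp only [sum_range_succ, sum_range_zero] at h4
    have := e 0 (by omega)
    have := e 1 (by omega)
    have := e 2 (by omega)
    omega
  have hsum := hc.2
  rw [← sum_subset h3 hzero] at hsum
  rw [level, ← sum_subset h3 fun i hi hi3 => by rw [hzero i hi hi3, zero_mul]]
  simp only [sum_range_succ, sum_range_zero] at hsum ⊢
  have := hc.1 0 (by omega)
  have := hc.1 1 (by omega)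
  have := hc.1 2 (by omega)
  have := h 0 (by omega)
  have := h 1 (by omega)
  simp only [Nat.reduceAdd] at *
  omega

theorem IsMultiplicity.reflect (hc : IsMultiplicity k n r c) :
    IsMultiplicity k n r fun i => c (k - 1 - i) :=
  ⟨fun i hi => hc.1 _ (by omega), by rw [sum_range_reflect c k, hc.2]⟩

theorem IsMultiplicity.level_add_level_reflect (hc : IsMultiplicity k n r c) :
    level k c + level k (fun i => c (k - 1 - i)) = n * (k - 1) := by
  have h : level k (fun i => c (k - 1 - i)) = ∑ i ∈ range k, c i * (k - 1 - i) := by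
    rw [level, ← sum_range_reflect]
    refine sum_congr rfl fun i hi => ?_
    rw [mem_range] at hi
    rw [show k - 1 - (k - 1 - i) = i by omega]
  rw [h, level, ← sum_add_distrib, ← hc.2, sum_mul]
  refine sum_congr rfl fun i hi => ?_
  rw [mem_range] at hi
  rw [← mul_add, show i + (k - 1 - i) = k - 1 by omega]

theorem IsMultiplicity.sum_smul_add_smul {G : Type*} [AddCommGroup G] (hc : IsMultiplicity k n r c)
    (b d : G) :
    ∑ i ∈ range k, c i • (b + i • d) = n • b + level k c • d := by
  simp only [smul_add, sum_add_distrib, ← mul_smul, ← sum_smul, hc.2, level]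

end Move

theorem Finset.exists_strictMonoOn_image_range {α : Type*} [LinearOrder α] [DecidableEq α]
    [Nonempty α] (A : Finset α) :
    ∃ a : ℕ → α, StrictMonoOn a (range #A) ∧ (range #A).image a = A := by
  classical
  let a : ℕ → α := fun i => if h : i < #A then A.orderEmbOfFin rfl ⟨i, h⟩ else Classical.arbitrary α
  have hlt : ∀ i (h : i < #A), a i = A.orderEmbOfFin rfl ⟨i, h⟩ := fun i h => dif_pos h
  refine ⟨a, fun i hi j hj hij => ?_, ?_⟩
  · simp only [coe_range, Set.mem_Iio] at hi hj
    rw [hlt i hi, hlt j hj]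
    exact (A.orderEmbOfFin rfl).strictMono hij
  · ext x
    rw [← Finset.mem_coe (s := A), ← A.range_orderEmbOfFin rfl]
    simp only [mem_image, mem_range, Set.mem_range]
    constructor
    · rintro ⟨i, hi, rfl⟩
      exact ⟨⟨i, hi⟩, (hlt i hi).symm⟩
    · rintro ⟨i, rfl⟩
      exact ⟨i, i.2, hlt i i.2⟩

/-! ### Sums with bounded multiplicities in an ordered group -/

section Ordered

variable {G : Type*} [AddCommGroup G] [LinearOrder G] [IsOrderedAddMonoid G]
  {k n r β : ℕ} {a : ℕ → G} {S : Finset G}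

/-- Multiplicities that are not packed at the bottom have a neighbour one level lower with a smaller
sum. -/
theorem exists_lower (ha : StrictMonoOn a (range k)) (hk : 3 ≤ k) (hn : 2 < n)
    (hβ : n = 2 * r + 1 ∧ β = r + 2 ∨ n ≤ 2 * r ∧ 2 * r ≤ n + 1 ∧ n = β + r)
    (c : ℕ → ℕ) (hc : IsMultiplicity k n r c) :
    (level k c : ℤ) = β ∨ ∃ c', IsMultiplicity k n r c' ∧ (level k c : ℤ) = level k c' + 1 ∧
      ∑ i ∈ range k, c' i • a i < ∑ i ∈ range k, c i • a i := by
  by_cases h : ∀ i, i + 1 < k → c (i + 1) = 0 ∨ r ≤ c i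
  · exact Or.inl (by exact_mod_cast hc.level_eq_of_packed hk hn hβ h)
  · push Not at h
    obtain ⟨i, hi, h0, hr⟩ := h
    have hi' : i < k := by omega
    have h1 : 1 ≤ c (i + 1) := Nat.one_le_iff_ne_zero.2 h0
    refine Or.inr ⟨moveUnit c (i + 1) i, hc.moveUnit hi hi' (by omega) h1 hr, ?_, ?_⟩
    · have := level_moveUnit_add hi hi' (by omega) h1
      omega
    · have e := sum_moveUnit_add a hi hi' (by omega) h1
      have hlt : a i < a (i + 1) := ha (by simpa using hi') (by simpa using hi) (by omega)
      rw [← add_lt_add_iff_right (a (i + 1)), e]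
      exact add_lt_add_right hlt _

/-- The counterpart of `exists_lower`; the top-packed multiplicities are the reflections
`i ↦ k - 1 - i` of the bottom-packed ones. -/
theorem exists_upper (ha : StrictMonoOn a (range k)) (hk : 3 ≤ k) (hn : 2 < n)
    (hβ : n = 2 * r + 1 ∧ β = r + 2 ∨ n ≤ 2 * r ∧ 2 * r ≤ n + 1 ∧ n = β + r)
    (c : ℕ → ℕ) (hc : IsMultiplicity k n r c) :
    (level k c : ℤ) = n * (k - 1) - β ∨
      ∃ c', IsMultiplicity k n r c' ∧ (level k c' : ℤ) = level k c + 1 ∧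
      ∑ i ∈ range k, c i • a i < ∑ i ∈ range k, c' i • a i := by
  by_cases h : ∀ i, i + 1 < k → c i = 0 ∨ r ≤ c (i + 1)
  · have h1 := hc.reflect.level_eq_of_packed hk hn hβ fun i hi => by
      have := h (k - 1 - (i + 1)) (by omega)
      rwa [show k - 1 - (i + 1) + 1 = k - 1 - i by omega] at this
    have h2 := hc.level_add_level_reflect
    rw [h1] at h2
    zify [show 1 ≤ k by omega] at h2
    left
    linarith
  · push Not at h
    obtain ⟨i, hi, h0, hr⟩ := h
    have hi' : i < k := by omega
    have h1 : 1 ≤ c i := Nat.one_le_iff_ne_zero.2 h0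
    refine Or.inr ⟨moveUnit c i (i + 1), hc.moveUnit hi' hi (by omega) h1 hr, ?_, ?_⟩
    · have := level_moveUnit_add hi' hi (by omega) h1
      omega
    · have e := sum_moveUnit_add a hi' hi (by omega) h1
      have hlt : a i < a (i + 1) := ha (by simpa using hi') (by simpa using hi) (by omega)
      rw [← add_lt_add_iff_right (a i), e]
      exact add_lt_add_right hlt _

/-- Multiplicities `w`, `x`, `y`, `z` at the points `p`, `q`, `s`, `t`, added up where points
coincide. -/
theorem isMultiplicity_of_points {p q s t w x y z : ℕ} (hp : p < k) (hq : q < k) (hs : s < k)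
    (ht : t < k) (hsum : w + x + y + z = n)
    (hr : ∀ i, (if i = p then w else 0) + (if i = q then x else 0) + (if i = s then y else 0) +
      (if i = t then z else 0) ≤ r) :
    IsMultiplicity k n r fun i => (if i = p then w else 0) + (if i = q then x else 0) +
      (if i = s then y else 0) + (if i = t then z else 0) := by
  refine ⟨fun i _ => hr i, ?_⟩
  simp [sum_add_distrib, hp, hq, hs, ht, hsum]

theorem exists_isMultiplicity_of_le (hk : 3 ≤ k) (hn : 2 < n) (h1 : 2 * r ≤ n + 1)
    (h2 : n ≤ 2 * r + 1) : ∃ c, IsMultiplicity k n r c := by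
  refine ⟨_, isMultiplicity_of_points (p := 0) (q := 1) (s := 2) (t := 2) (w := r)
    (x := min r (n - r)) (y := n - r - min r (n - r)) (z := 0) (by omega) (by omega) (by omega)
    (by omega) (by omega) fun i => ?_⟩
  split_ifs <;> omega

theorem level_mem_Icc (ha : StrictMonoOn a (range k)) (hk : 3 ≤ k) (hn : 2 < n)
    (hβ : n = 2 * r + 1 ∧ β = r + 2 ∨ n ≤ 2 * r ∧ 2 * r ≤ n + 1 ∧ n = β + r)
    (hS : ∀ s, s ∈ S ↔ ∃ c, IsMultiplicity k n r c ∧ ∑ i ∈ range k, c i • a i = s)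
    {c : ℕ → ℕ} (hc : IsMultiplicity k n r c) :
    (level k c : ℤ) ∈ Icc (β : ℤ) (n * (k - 1) - β) := by
  have hmem : ∀ c, IsMultiplicity k n r c → ∑ i ∈ range k, c i • a i ∈ S :=
    fun c hc => (hS _).2 ⟨c, hc, rfl⟩
  have h1 := sub_level_le_card_lt (ℓ := fun c => (level k c : ℤ)) hmem
    (exists_upper ha hk hn hβ) c hc
  have h2 := level_sub_le_card_gt (ℓ := fun c => (level k c : ℤ)) hmem
    (exists_lower ha hk hn hβ) c hc
  exact mem_Icc.2 ⟨h2.1, h1.1⟩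

theorem le_card_boundedSums (ha : StrictMonoOn a (range k)) (hk : 3 ≤ k) (hn : 2 < n)
    (hβ : n = 2 * r + 1 ∧ β = r + 2 ∨ n ≤ 2 * r ∧ 2 * r ≤ n + 1 ∧ n = β + r)
    (hS : ∀ s, s ∈ S ↔ ∃ c, IsMultiplicity k n r c ∧ ∑ i ∈ range k, c i • a i = s) :
    (n * (k - 1) - 2 * β + 1 : ℤ) ≤ #S := by
  have hmem : ∀ c, IsMultiplicity k n r c → ∑ i ∈ range k, c i • a i ∈ S :=
    fun c hc => (hS _).2 ⟨c, hc, rfl⟩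
  obtain ⟨c, hc⟩ := exists_isMultiplicity_of_le hk hn (r := r) (by omega) (by omega)
  have h1 := sub_level_le_card_lt (ℓ := fun c => (level k c : ℤ)) hmem
    (exists_upper ha hk hn hβ) c hc
  have h2 := level_sub_le_card_gt (ℓ := fun c => (level k c : ℤ)) hmem
    (exists_lower ha hk hn hβ) c hc
  have h3 := card_filter_lt_add_card_filter_gt (hmem c hc)
  zify at h3
  linarith [h1.2, h2.2]

/-- In the extremal case, two moves available from the same multiplicity function lead to the same
level, hence to the same sum: the corresponding gaps of `a` are equal. -/
theorem gap_eq_of_card_eq (ha : StrictMonoOn a (range k)) (hk : 3 ≤ k) (hn : 2 < n)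
    (hβ : n = 2 * r + 1 ∧ β = r + 2 ∨ n ≤ 2 * r ∧ 2 * r ≤ n + 1 ∧ n = β + r)
    (hS : ∀ s, s ∈ S ↔ ∃ c, IsMultiplicity k n r c ∧ ∑ i ∈ range k, c i • a i = s)
    (hcard : (#S : ℤ) = n * (k - 1) - 2 * β + 1) {c : ℕ → ℕ} (hc : IsMultiplicity k n r c)
    {i j : ℕ} (hi : i + 1 < k) (hj : j + 1 < k) (hci : 1 ≤ c i) (hcj : 1 ≤ c j)
    (hci' : c (i + 1) < r) (hcj' : c (j + 1) < r) :
    a (i + 1) - a i = a (j + 1) - a j := by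
  have hmem : ∀ c, IsMultiplicity k n r c → ∑ i ∈ range k, c i • a i ∈ S :=
    fun c hc => (hS _).2 ⟨c, hc, rfl⟩
  have hi0 : i < k := by omega
  have hj0 : j < k := by omega
  have h1 := level_moveUnit_add hi0 hi (by omega) hci
  have h2 := level_moveUnit_add hj0 hj (by omega) hcj
  have h := value_eq_of_level_eq (ℓ := fun c => (level k c : ℤ)) hmem
    (exists_upper ha hk hn hβ) (exists_lower ha hk hn hβ) (by rw [hcard]; ring)
    (hc.moveUnit hi0 hi (by omega) hci hci') (hc.moveUnit hj0 hj (by omega) hcj hcj')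
    (by omega)
  have e1 := sum_moveUnit_add a hi0 hi (by omega) hci
  have e2 := sum_moveUnit_add a hj0 hj (by omega) hcj
  rw [h] at e1
  rw [← sub_eq_iff_eq_add'] at e1 e2
  calc a (i + 1) - a i = (∑ t ∈ range k, c t • a t + a (i + 1)) - a i -
        ∑ t ∈ range k, c t • a t := by abel
    _ = (∑ t ∈ range k, c t • a t + a (j + 1)) - a j - ∑ t ∈ range k, c t • a t := by
        rw [← e1, ← e2]; abel
    _ = _ := by abel

/-- Extremal sumsets force all gaps of `a` to be equal. If `r ≥ 2`, adjacent gaps are compared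
through three consecutive indices (and a fourth one if `n = 5` and `r = 2`). If `r = 1`, only gaps
without a common endpoint can be compared, and five points are needed for that. -/
theorem gap_eq_gap_zero (ha : StrictMonoOn a (range k)) (hk : 3 ≤ k) (hn : 2 < n)
    (hβ : n = 2 * r + 1 ∧ β = r + 2 ∨ n ≤ 2 * r ∧ 2 * r ≤ n + 1 ∧ n = β + r)
    (hS : ∀ s, s ∈ S ↔ ∃ c, IsMultiplicity k n r c ∧ ∑ i ∈ range k, c i • a i = s)
    (hcard : (#S : ℤ) = n * (k - 1) - 2 * β + 1)
    (h1 : r = 1 → 5 ≤ k) (h2 : r = 2 → n = 5 → 4 ≤ k) :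
    ∀ i, i + 1 < k → a (i + 1) - a i = a 1 - a 0 := by
  rcases Nat.lt_or_ge 1 r with hr | hr
  · have hadj : ∀ i, i + 2 < k → a (i + 1) - a i = a (i + 1 + 1) - a (i + 1) := by
      intro i hi
      by_cases h5 : r = 2 ∧ n = 5
      · have := h2 h5.1 h5.2
        obtain ⟨l, hl, hl0, hl1, hl2⟩ : ∃ l < k, l ≠ i ∧ l ≠ i + 1 ∧ l ≠ i + 2 := by
          rcases Nat.eq_zero_or_pos i with rfl | hi0
          · exact ⟨3, by omega, by omega, by omega, by omega⟩
          · exact ⟨0, by omega, by omega, by omega, by omega⟩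
        refine gap_eq_of_card_eq ha hk hn hβ hS hcard
          (isMultiplicity_of_points (p := i) (q := i + 1) (s := i + 2) (t := l) (w := 2) (x := 1)
            (y := 1) (z := 1) (by omega) (by omega) (by omega) hl (by omega) fun t => ?_)
          (by omega) (by omega) ?_ ?_ ?_ ?_
        all_goals split_ifs <;> omega
      · refine gap_eq_of_card_eq ha hk hn hβ hS hcard
          (isMultiplicity_of_points (p := i) (q := i + 1) (s := i + 2) (t := i) (w := r)
            (x := if n = 2 * r + 1 then 2 else 1)
            (y := n - r - if n = 2 * r + 1 then 2 else 1) (z := 0)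
            (by omega) (by omega) (by omega) (by omega) (by split_ifs <;> omega) fun t => ?_)
          (by omega) (by omega) ?_ ?_ ?_ ?_
        all_goals split_ifs <;> omega
    intro i
    induction i with
    | zero => exact fun _ => rfl
    | succ i ih => exact fun hi => (hadj i hi).symm.trans (ih (by omega))
  · have hr1 : r = 1 := by omega
    have hk5 := h1 hr1
    have hsep : ∀ i j, i + 2 ≤ j → j + 1 < k → a (i + 1) - a i = a (j + 1) - a j := by
      intro i j hij hj
      obtain ⟨l, hl, hl'⟩ : ∃ l < k, l ≠ i ∧ l ≠ i + 1 ∧ l ≠ j ∧ l ≠ j + 1 := by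
        by_contra! h
        have := h 0 (by omega)
        have := h 1 (by omega)
        have := h 2 (by omega)
        have := h 3 (by omega)
        have := h 4 (by omega)
        omega
      refine gap_eq_of_card_eq ha hk hn hβ hS hcard
        (isMultiplicity_of_points (p := i) (q := j) (s := l) (t := l) (w := 1) (x := 1)
          (y := 1) (z := 0) (by omega) (by omega) (by omega) hl (by omega) fun t => ?_)
        (by omega) (by omega) ?_ ?_ ?_ ?_
      all_goals split_ifs <;> omega
    intro i hi
    match i, hi with
    | 0, _ => rfl
    | 1, _ => exact (hsep 1 3 (by omega) (by omega)).trans (hsep 0 3 (by omega) (by omega)).symm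
    | i + 2, hi => exact (hsep 0 (i + 2) (by omega) hi).symm

variable [DecidableEq G] {A : Finset G}

/-- The common form of the extremal characterizations: `r` is the bound on multiplicities and `β`
the lowest level of a multiset of size `n`. -/
theorem card_boundedSums_eq_iff (hk : 3 ≤ #A) (hn : 2 < n)
    (hβ : n = 2 * r + 1 ∧ β = r + 2 ∨ n ≤ 2 * r ∧ 2 * r ≤ n + 1 ∧ n = β + r)
    (hS : ∀ a : ℕ → G, Set.InjOn a (range #A) → (range #A).image a = A →
      ∀ s, s ∈ S ↔ ∃ c, IsMultiplicity #A n r c ∧ ∑ i ∈ range #A, c i • a i = s)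
    (h1 : r = 1 → 5 ≤ #A) (h2 : r = 2 → n = 5 → 4 ≤ #A) :
    (#S : ℤ) = n * (#A - 1) - 2 * β + 1 ↔ IsArithProg A := by
  obtain ⟨a, ha, haA⟩ := A.exists_strictMonoOn_image_range
  have hSa := hS a ha.injOn haA
  constructor
  · intro hcard
    have hgap := gap_eq_gap_zero ha hk hn hβ hSa hcard h1 h2
    have hlin : ∀ i < #A, a i = a 0 + i • (a 1 - a 0) := by
      intro i
      induction i with
      | zero => simp
      | succ i ih =>
        intro hi
        rw [← sub_add_cancel (a (i + 1)) (a i), hgap i hi, ih (by omega), succ_nsmul]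
        abel
    refine ⟨a 0, a 1 - a 0, ?_⟩
    conv_lhs => rw [← haA]
    exact image_congr fun i hi => hlin i (by simpa using hi)
  · rintro ⟨b, d, hA⟩
    have hinj : Set.InjOn (fun i : ℕ => b + i • d) (range #A) := by
      rw [← card_image_iff, ← hA, card_range]
    refine le_antisymm ?_ (le_card_boundedSums ha hk hn hβ hSa)
    have hsub : S ⊆ (Icc (β : ℤ) (n * (#A - 1) - β)).image fun l => n • b + l • d := by
      intro s hs
      obtain ⟨c, hc, rfl⟩ := (hS _ hinj hA.symm s).1 hs
      refine mem_image.2 ⟨level #A c, level_mem_Icc ha hk hn hβ hSa hc, ?_⟩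
      rw [hc.sum_smul_add_smul, natCast_zsmul]
    have h3 := (card_le_card hsub).trans card_image_le
    have h4 := le_card_boundedSums ha hk hn hβ hSa
    -- The interval of levels is nonempty, so its cardinality does not truncate.
    obtain ⟨c, hc⟩ := exists_isMultiplicity_of_le hk hn (r := r) (by omega) (by omega)
    have h5 := mem_Icc.1 (level_mem_Icc ha hk hn hβ hSa hc)
    rw [Int.card_Icc] at h3
    zify at h3
    rw [Int.toNat_of_nonneg (by linarith [h5.1, h5.2])] at h3
    linarith

end Ordered

/-! ### The small cases -/

section Small

variable {G : Type*} [AddCommGroup G] {a : ℕ → G} {S : Finset G}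

theorem card_le_three_of_five_two [DecidableEq G]
    (hS : ∀ s ∈ S, ∃ c, IsMultiplicity 3 5 2 c ∧ ∑ i ∈ range 3, c i • a i = s) : #S ≤ 3 := by
  have hsub : S ⊆ {1 • a 0 + 2 • a 1 + 2 • a 2, 2 • a 0 + 1 • a 1 + 2 • a 2,
      2 • a 0 + 2 • a 1 + 1 • a 2} := by
    intro s hs
    obtain ⟨c, ⟨hr, hc⟩, rfl⟩ := hS s hs
    have h0 := hr 0 (by omega)
    have h1 := hr 1 (by omega)
    have h2 := hr 2 (by omega)
    simp only [sum_range_succ, sum_range_zero, zero_add] at hc ⊢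
    have : (c 0 = 1 ∧ c 1 = 2 ∧ c 2 = 2) ∨ (c 0 = 2 ∧ c 1 = 1 ∧ c 2 = 2) ∨
        (c 0 = 2 ∧ c 1 = 2 ∧ c 2 = 1) := by omega
    rcases this with ⟨e0, e1, e2⟩ | ⟨e0, e1, e2⟩ | ⟨e0, e1, e2⟩ <;> simp [e0, e1, e2]
  exact (card_le_card hsub).trans card_le_three

theorem card_le_one_of_three_one
    (hS : ∀ s ∈ S, ∃ c, IsMultiplicity 3 3 1 c ∧ ∑ i ∈ range 3, c i • a i = s) : #S ≤ 1 := by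
  have hsub : S ⊆ {a 0 + a 1 + a 2} := by
    intro s hs
    obtain ⟨c, ⟨hr, hc⟩, rfl⟩ := hS s hs
    have h0 := hr 0 (by omega)
    have h1 := hr 1 (by omega)
    have h2 := hr 2 (by omega)
    simp only [sum_range_succ, sum_range_zero, zero_add] at hc ⊢
    have : c 0 = 1 ∧ c 1 = 1 ∧ c 2 = 1 := by omega
    simp [this]
  exact (card_le_card hsub).trans (card_singleton _).le

theorem card_le_four_of_three_one [DecidableEq G]
    (hS : ∀ s ∈ S, ∃ c, IsMultiplicity 4 3 1 c ∧ ∑ i ∈ range 4, c i • a i = s) : #S ≤ 4 := by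
  have hsub : S ⊆ {a 1 + a 2 + a 3, a 0 + a 2 + a 3, a 0 + a 1 + a 3, a 0 + a 1 + a 2} := by
    intro s hs
    obtain ⟨c, ⟨hr, hc⟩, rfl⟩ := hS s hs
    have h0 := hr 0 (by omega)
    have h1 := hr 1 (by omega)
    have h2 := hr 2 (by omega)
    have h3 := hr 3 (by omega)
    simp only [sum_range_succ, sum_range_zero, zero_add] at hc ⊢
    have : (c 0 = 0 ∧ c 1 = 1 ∧ c 2 = 1 ∧ c 3 = 1) ∨ (c 0 = 1 ∧ c 1 = 0 ∧ c 2 = 1 ∧ c 3 = 1) ∨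
        (c 0 = 1 ∧ c 1 = 1 ∧ c 2 = 0 ∧ c 3 = 1) ∨ (c 0 = 1 ∧ c 1 = 1 ∧ c 2 = 1 ∧ c 3 = 0) := by
      omega
    rcases this with ⟨e0, e1, e2, e3⟩ | ⟨e0, e1, e2, e3⟩ | ⟨e0, e1, e2, e3⟩ | ⟨e0, e1, e2, e3⟩ <;>
      simp [e0, e1, e2, e3]
  exact (card_le_card hsub).trans card_le_four

end Small

/-! ### The extremal characterizations -/

theorem theorem1p5 {G : Type*} [AddCommGroup G] [IsAddTorsionFree G] [DecidableEq G]
    (n : ℕ) (hn : 2 < n) (A : Finset G) (hA : 3 ≤ A.card) :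
    (((linearMultiple n A).card : ℤ) = n * A.card - 2 * n + 1 + ((n % 2 : ℕ) : ℤ) ↔
      IsArithProg A) ∧
    (((circularMultiple n A).card : ℤ) =
        n * A.card - 2 * n + (-1) ^ n * (1 + ((n % 2 : ℕ) : ℤ)) ↔
      IsArithProg A ∨ (A.card = 3 ∧ n = 5) ∨ (n = 3 ∧ (A.card = 3 ∨ A.card = 4))) := by
  obtain ⟨_, _⟩ := exists_linearOrder_isOrderedAddMonoid G
  have hL : ∀ a : ℕ → G, Set.InjOn a (range #A) → (range #A).image a = A →
      ∀ s, s ∈ linearMultiple n A ↔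
        ∃ c, IsMultiplicity #A n ((n + 1) / 2) c ∧ ∑ i ∈ range #A, c i • a i = s := by
    intro a ha haA s
    rw [← mem_linearMultiple_iff ha, haA]
  have hC : ∀ a : ℕ → G, Set.InjOn a (range #A) → (range #A).image a = A →
      ∀ s, s ∈ circularMultiple n A ↔
        ∃ c, IsMultiplicity #A n (n / 2) c ∧ ∑ i ∈ range #A, c i • a i = s := by
    intro a ha haA s
    rw [← mem_circularMultiple_iff ha, haA]
  rcases Nat.even_or_odd' n with ⟨m, rfl | rfl⟩
  · rw [show (2 * m + 1) / 2 = m by omega] at hL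
    rw [show 2 * m / 2 = m by omega] at hC
    rw [← card_boundedSums_eq_iff hA hn (β := m) (by omega) hL (by omega) (by omega)]
    refine ⟨?_, ?_⟩
    · rw [show 2 * m % 2 = 0 by omega]
      push_cast
      ring_nf
    · rw [card_boundedSums_eq_iff hA hn (β := m) (by omega) hL (by omega) (by omega),
        ← card_boundedSums_eq_iff hA hn (β := m) (by omega) hC (by omega) (by omega),
        or_iff_left (by omega), show 2 * m % 2 = 0 by omega, (even_two_mul m).neg_one_pow]
      push_cast
      ring_nf
  · rw [show (2 * m + 1 + 1) / 2 = m + 1 by omega] at hL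
    rw [show (2 * m + 1) / 2 = m by omega] at hC
    rw [show (2 * m + 1) % 2 = 1 by omega, (odd_two_mul_add_one m).neg_one_pow]
    refine ⟨?_, ?_⟩
    · rw [← card_boundedSums_eq_iff hA hn (β := m) (by omega) hL (by omega) (by omega)]
      push_cast
      ring_nf
    · by_cases hex : (#A = 3 ∧ m = 2) ∨ (m = 1 ∧ (#A = 3 ∨ #A = 4))
      · rw [iff_true_right (Or.inr (by omega))]
        obtain ⟨a, ha, haA⟩ := A.exists_strictMonoOn_image_range
        have hCa := hC a ha.injOn haA
        have hle := le_card_boundedSums ha hA hn (β := m + 2) (by omega) hCa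
        have hC' := fun s hs => (hCa s).1 hs
        generalize circularMultiple (2 * m + 1) A = T at hC' hle ⊢
        rcases hex with ⟨h, rfl⟩ | ⟨rfl, h | h⟩
        · rw [h] at hC' hle ⊢
          have := card_le_three_of_five_two hC'
          push_cast at hle ⊢
          omega
        · rw [h] at hC' hle ⊢
          have := card_le_one_of_three_one hC'
          push_cast at hle ⊢
          omega
        · rw [h] at hC' hle ⊢
          have := card_le_four_of_three_one hC'
          push_cast at hle ⊢
          omega
      · rw [← card_boundedSums_eq_iff hA hn (β := m + 2) (by omega) hC (by omega) (by omega),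
          or_iff_left (by omega)]
        push_cast
        ring_nf
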